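/- Let \(r\ge 1\). An \(r\)-graph \(G\) consists of a finite vertex set \(V(G)\) and a set \(E(G)\) of \(r\)-element subsets of \(V(G)\); its order is \(|V(G)|\) and its density is \(|E(G)|/\binom{|V(G)|}{r}\). A number \(\alpha\in[0,1)\) is a *jump* for \(r\)-graphs if there is \(\delta>0\) such that for every \(\varepsilon>0\) and every integer \(n\ge r\), every sufficiently large \(r\)-graph of density at least \(\alpha+\varepsilon\) has a (not necessarily induced) subgraph of order \(n\) and density at least \(\alpha+\delta\). Only numbers in \([0,1)\) can be jumps. An \(r\)-pattern \(P\) consists of a finite vertex set \(V(P)\) and a set \(E(P)\) of multisets of size \(r\) on \(V(P)\); write \(m_e(u)\) for the multiplicity of \(u\) in the edge \(e\). A weighting of \(P\) is a function \(w:V(P)\to[0,\infty)\) with \(\sum_u w(u)=1\). Put \[w(P)=\sum_{e\in E(P)}\ \prod_{u\in V(P)}\frac{w(u)^{m_e(u)}}{m_e(u)!},\qquad \lambda(P)=\max_w w(P),\] and call \(w\) maximal if \(w(P)=\lambda(P)\). For \(v\in V(P)\), the Frankl–Rödl construction \(\mathrm{FR}_v(P)\) is the following \(r\)-pattern. Its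 vertices are the pairs \((v,1),\dots,(v,r)\) together with one vertex \((u,1)\) for each \(u\in V(P)\) with \(u\ne v\). Its edges are the multiset \(\{(v,1),\dots,(v,r)\}\) and all multisets \(e=\{(u_1,i_1),\dots,(u_r,i_r)\}\) of its vertices such that the multiset \(\{u_1,\dots,u_r\}\) is an edge of \(P\) and \(m_e((v,i))\le 1\) for all \(i\in\{2,\dots,r\}\). **Theorem.** Let \(P\) be an \(r\)-pattern and let \(v\) be a vertex of \(P\) to which some maximal weighting of \(P\) gives positive weight. If \[\lambda(\mathrm{FR}_v(P))=\lambda(P)<1,\] then \(r!\,\lambda(P)\) is not a jump for \(r\)-graphs. -/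

import Mathlib

/-- An `r`-uniform hypergraph (`r`-graph) with finite vertex set `verts` contained in the type `V`. -/
structure RGraph (r : ℕ) (V : Type*) where
  verts : Finset V
  edges : Finset (Finset V)
  edges_subset : edges ⊆ verts.powersetCard r

namespace RGraph

variable {r : ℕ} {V : Type*}

/-- The order of an `r`-graph: its number of vertices. -/
def order (G : RGraph r V) : ℕ := G.verts.card

/-- The density of an `r`-graph: the proportion of the `r`-subsets of the vertex set that are
edges. -/
noncomputable def density (G : RGraph r V) : ℝ :=
  (G.edges.card : ℝ) / ((G.verts.powersetCard r).card : ℝ)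

/-- `H` is a (not necessarily induced) subgraph of `G`. -/
def IsSubgraph (H G : RGraph r V) : Prop :=
  H.verts ⊆ G.verts ∧ H.edges ⊆ G.edges

end RGraph

/-- `α ∈ [0,1)` is a jump for `r`-graphs if there is `δ > 0` such that for all `ε > 0` and
`n ≥ r`, every sufficiently large `r`-graph of density at least `α + ε` has a subgraph of order `n`
and density at least `α + δ`. -/
def IsJump (r : ℕ) (α : ℝ) : Prop :=
  (0 ≤ α ∧ α < 1) ∧
    ∃ δ : ℝ, 0 < δ ∧ ∀ ε : ℝ, 0 < ε → ∀ n : ℕ, r ≤ n →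
      ∃ N : ℕ, ∀ (V : Type) (G : RGraph r V), N ≤ G.order → α + ε ≤ G.density →
        ∃ H : RGraph r V, H.IsSubgraph G ∧ H.order = n ∧ α + δ ≤ H.density

/-- An `r`-pattern on the vertex set `V`: a set of edges, each of which is a multiset of size `r`
of vertices. -/
structure Pattern (r : ℕ) (V : Type*) where
  edges : Finset (Sym V r)

namespace Pattern

variable {r : ℕ} {V : Type*} [Fintype V] [DecidableEq V]

/-- The weight `∏ v, w(v) ^ m_e(v) / m_e(v)!` of an edge `e`, where `m_e(v)` is the multiplicity of
`v` in `e`. -/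
noncomputable def edgeWeight (w : V → ℝ) (e : Sym V r) : ℝ :=
  ∏ v : V, w v ^ ((e : Multiset V).count v) / (((e : Multiset V).count v).factorial : ℝ)

/-- The weight `w(P)` of a pattern: the sum of the weights of its edges. -/
noncomputable def weight (P : Pattern r V) (w : V → ℝ) : ℝ :=
  ∑ e ∈ P.edges, edgeWeight w e

/-- The Lagrangian `λ(P)`: the maximum of `w(P)` over all weightings `w`, that is, over all
nonnegative `w : V → ℝ` with total weight `1`. -/
noncomputable def lagrangian (P : Pattern r V) : ℝ :=
  sSup (P.weight '' stdSimplex ℝ V)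

/-- A maximal weighting: a weighting at which the Lagrangian is attained. -/
def IsMaximalWeighting (P : Pattern r V) (w : V → ℝ) : Prop :=
  w ∈ stdSimplex ℝ V ∧ P.weight w = P.lagrangian

/-- On a nonempty vertex set the supremum in `lagrangian` is a maximum. -/
theorem exists_isMaximalWeighting [Nonempty V] (P : Pattern r V) :
    ∃ w, P.IsMaximalWeighting w := by
  have hc : ContinuousOn P.weight (stdSimplex ℝ V) := by
    apply Continuous.continuousOn
    unfold weight edgeWeight
    fun_prop
  obtain ⟨w, hw, h⟩ := (isCompact_stdSimplex ℝ V).exists_sSup_image_eq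
    ⟨_, single_mem_stdSimplex ℝ (Classical.arbitrary V)⟩ hc
  exact ⟨w, hw, h.symm⟩

/-- The blow-up `P(k)`: its vertices are the pairs `(u, i)` with `i < k u`, and a multiset of size
`r` of such pairs is an edge if and only if its projection to `V` is an edge of `P`. -/
def blowUp (P : Pattern r V) (k : V → ℕ) : Pattern r (Σ u : V, Fin (k u)) where
  edges := Finset.univ.filter fun e => e.map Sigma.fst ∈ P.edges

/-- The multiplicities `k` of the Frankl–Rödl construction: `k v = r`, and `k u = 1` for `u ≠ v`. -/
def frMult (r : ℕ) (v : V) (u : V) : ℕ := if u = v then r else 1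

/-- The edge `{(v,1), …, (v,r)}`. -/
def frEdge (r : ℕ) (v : V) : Sym (Σ u : V, Fin (frMult r v u)) r :=
  ⟨(Finset.univ : Finset (Fin (frMult r v v))).val.map fun i => ⟨v, i⟩, by
    rw [Multiset.card_map, Finset.card_val, Finset.card_univ, Fintype.card_fin, frMult, if_pos rfl]⟩

/-- The Frankl–Rödl construction `FR_v(P)`. The copies `(v,1), …, (v,r)` of `v` are indexed by
`0, …, r - 1`, so that `i ≠ 0` describes the copies `(v,2), …, (v,r)`: keep those edges of the
blow-up in which each of these has multiplicity at most one, and add the edge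
`{(v,1), …, (v,r)}`. -/
def franklRodl (P : Pattern r V) (v : V) : Pattern r (Σ u : V, Fin (frMult r v u)) where
  edges := insert (frEdge r v) ((P.blowUp (frMult r v)).edges.filter fun e =>
    ∀ i : Fin (frMult r v v), (i : ℕ) ≠ 0 →
      (e : Multiset (Σ u : V, Fin (frMult r v u))).count ⟨v, i⟩ ≤ 1)

end Pattern

/-!
Suppose that `α = r! λ(P)` were a jump, with gap `δ`. Fix `n` so large that an `r`-graph with `n`
vertices and density at least `α + δ` has more than `λ(P) n ^ r` edges. It suffices to find
arbitrarily large `r`-graphs of density at least `α + ε`, for some `ε > 0`, in which every set of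
`n` vertices spans at most `λ(P) n ^ r` edges.

These are blow-ups of a pattern `Q` (`Pattern.sparseExtension`): replace every vertex of `P` by `t`
copies, keep the edges whose copies have distinct indices, and add on the copies of `v` an `r`-graph
`A` that has at least `c t ^ (r - 1)` edges although any `u ≤ n` vertices, `u ≥ r - 1`, span at most
`u - (r - 1)` of them. Such an `A` exists by the deletion method (`exists_locally_sparse`).

* Dividing a maximal weighting `w` of `P` equally among the copies loses a proportion `O(1 / t)` of
  the weight, because of the edges that are not kept, and the edges of `A` contribute at least
  `c w(v) ^ r / t`. So `Q` has weight greater than `λ(P)` once `c` is large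
  (`Pattern.weight_lt_weight_sparseExtension`). A random blow-up has expected density `r!` times the
  weight of `Q` (`Pattern.exists_card_pullback_ge`).
* The number of edges of a subgraph with `n` vertices is at most the weight of `Q` when each vertex
  of `Q` is weighted by the number of vertices above it (`RGraph.IsSubgraph.card_edges_le`). Only
  `n` copies of `v` have positive weight then, and on these local sparsity bounds the weight of `A`
  by that of the edges `R ∪ {i}`, where `R` consists of the `r - 1` heaviest copies
  (`exists_sum_prod_le`). Sending `R` to `(v, 2), …, (v, r)` and all other copies of `v` to `(v, 1)`
  maps the kept edges to edges of `FR_v(P)`, and the weight of `A` is at most that of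
  `{(v, 1), …, (v, r)}`. Thus the number of edges is at most `n ^ r λ(FR_v(P)) = n ^ r λ(P)`
  (`Pattern.weight_sparseExtension_le`).

The edge `{v, …, v}` has to be excluded, since it would make edges of `A` coincide with edges of the
blow-up. If it belongs to `P`, then `α ≥ 1`, which is not a jump by definition.

Weights are handled through `Pattern.sum_tuples_eq`, which turns the weight of a set of multisets
into a sum over `r`-tuples of vertices; probabilities and push-forwards are then immediate.
-/

namespace Pattern

/-! ### Weights as sums over tuples -/

/-- The multiset of values of a family indexed by a type with `r` elements. -/
def tupleSym {r : ℕ} {W ι : Type*} [Fintype ι] (hι : Fintype.card ι = r) (g : ι → W) : Sym W r :=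
  ⟨(Finset.univ : Finset ι).val.map g, by simpa using hι⟩

theorem tupleSym_comp {r : ℕ} {W W' ι : Type*} [Fintype ι] (hι : Fintype.card ι = r)
    (φ : W → W') (g : ι → W) :
    tupleSym hι (φ ∘ g) = (tupleSym hι g).map φ := by
  apply Subtype.ext
  simp [tupleSym]

open MvPolynomial in
/-- Compare the coefficients of both expansions of `(∑ w, X w) ^ r`. -/
theorem card_tupleSym_eq_mul {r : ℕ} {W ι : Type*} [Fintype W] [DecidableEq W] [Fintype ι]
    [DecidableEq ι] (hι : Fintype.card ι = r) (e : Sym W r) :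
    (Finset.univ.filter fun g : ι → W => tupleSym hι g = e).card
      * ∏ w : W, ((e : Multiset W).count w).factorial = r.factorial := by
  have hsum : ∑ w : W, (e : Multiset W).count w = r := by
    rw [Multiset.sum_count_eq_card (fun w _ => Finset.mem_univ w)]; exact e.2
  have key : (Finset.univ.filter fun g : ι → W => tupleSym hι g = e).card
      = Nat.multinomial Finset.univ fun w => (e : Multiset W).count w := by
    have h1 : (∑ w : W, (X w : MvPolynomial W ℕ)) ^ r = ∑ g : ι → W, ∏ i, X (g i) := by
      rw [← hι, ← Finset.card_univ, ← Finset.prod_const, Finset.prod_univ_sum]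
      simp
    have h2 := Finset.sum_pow_eq_sum_piAntidiag Finset.univ
      (fun w : W => (X w : MvPolynomial W ℕ)) r
    rw [h1] at h2
    have h3 := congrArg (coeff (Multiset.toFinsupp (e : Multiset W))) h2
    have hX : ∀ g : ι → W, ∏ i, (X (g i) : MvPolynomial W ℕ)
        = monomial (Multiset.toFinsupp (tupleSym hι g : Multiset W)) 1 := by
      intro g
      have : Multiset.toFinsupp (tupleSym hι g : Multiset W)
          = ∑ i, Finsupp.single (g i) 1 := by
        simp only [tupleSym, Sym.coe_mk]
        rw [← Multiset.sum_map_singleton ((Finset.univ : Finset ι).val.map g),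
          map_multiset_sum, Multiset.map_map, Multiset.map_map]
        simp
      rw [this, monomial_sum_one]
      rfl
    have hY : ∀ k : W → ℕ, ∏ w, (X w : MvPolynomial W ℕ) ^ k w
        = monomial (Finsupp.equivFunOnFinite.symm k) 1 := by
      intro k
      rw [monomial_eq, Finsupp.prod_fintype _ _ (by simp)]
      simp
    rw [coeff_sum, coeff_sum] at h3
    rw [Finset.sum_eq_single (fun w => (e : Multiset W).count w)] at h3
    · rw [hY, ← map_natCast (C : ℕ →+* MvPolynomial W ℕ), coeff_C_mul, coeff_monomial,
        if_pos] at h3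
      · rw [Finset.card_filter, ← Nat.cast_id (Nat.multinomial _ _), ← mul_one (Nat.cast _), ← h3]
        refine Finset.sum_congr rfl fun g _ => ?_
        rw [hX, coeff_monomial]
        congr 1
        rw [EmbeddingLike.apply_eq_iff_eq]
        exact propext Subtype.ext_iff
      · ext w; simp
    · intro k _ hk
      rw [hY, ← map_natCast (C : ℕ →+* MvPolynomial W ℕ), coeff_C_mul, coeff_monomial, if_neg,
        mul_zero]
      intro h
      apply hk
      ext w
      simpa using DFunLike.congr_fun h w
    · intro h
      exact absurd (by simp [Finset.mem_piAntidiag, hsum]) h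
  rw [key, mul_comm, Nat.multinomial_spec, hsum]

/-- Up to the factor `r!`, the weight of a set of multisets is the weight of all tuples whose
multiset of values belongs to the set. -/
theorem sum_tuples_eq {r : ℕ} {W ι : Type*} [Fintype W] [DecidableEq W] [Fintype ι]
    [DecidableEq ι] (hι : Fintype.card ι = r) (E : Finset (Sym W r)) (y : W → ℝ) :
    (∑ g : ι → W, if tupleSym hι g ∈ E then ∏ i, y (g i) else 0)
      = r.factorial * ∑ e ∈ E, edgeWeight y e := by
  rw [← Finset.sum_filter,
    ← Finset.sum_fiberwise_of_maps_to (g := tupleSym hι) (t := E) (by simp), Finset.mul_sum]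
  refine Finset.sum_congr rfl fun e he => ?_
  have h1 : ∀ g ∈ (Finset.univ.filter fun g : ι → W => tupleSym hι g ∈ E).filter
      (fun g => tupleSym hι g = e), ∏ i, y (g i) = ∏ w, y w ^ (e : Multiset W).count w := by
    intro g hg
    have hg' : tupleSym hι g = e := (Finset.mem_filter.1 hg).2
    have h2 : ∏ i, y (g i) = ((e : Multiset W).map y).prod := by
      rw [← hg']
      simp [tupleSym, Multiset.map_map]
    rw [h2, Finset.prod_multiset_map_count]
    refine Finset.prod_subset (Finset.subset_univ _) fun w _ hw => ?_
    rw [Multiset.count_eq_zero_of_notMem (by simpa using hw), pow_zero]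
  rw [Finset.sum_congr rfl h1, Finset.sum_const, nsmul_eq_mul]
  have h3 : (Finset.univ.filter fun g : ι → W => tupleSym hι g ∈ E).filter
      (fun g => tupleSym hι g = e) = Finset.univ.filter fun g : ι → W => tupleSym hι g = e := by
    ext g
    simp only [Finset.mem_filter, Finset.mem_univ, true_and]
    exact ⟨fun h => h.2, fun h => ⟨h ▸ he, h⟩⟩
  have h4 : ((Finset.univ.filter fun g : ι → W => tupleSym hι g = e).card : ℝ)
      * ∏ w : W, (((e : Multiset W).count w).factorial : ℝ) = r.factorial := by
    exact_mod_cast card_tupleSym_eq_mul hι e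
  rw [h3, edgeWeight, Finset.prod_div_distrib, ← h4]
  have : (∏ w : W, (((e : Multiset W).count w).factorial : ℝ)) ≠ 0 :=
    Finset.prod_ne_zero_iff.2 fun w _ => by positivity
  field_simp

theorem edgeWeight_nonneg {r : ℕ} {W : Type*} [Fintype W] [DecidableEq W] {y : W → ℝ}
    (hy : ∀ w, 0 ≤ y w) (e : Sym W r) : 0 ≤ edgeWeight y e :=
  Finset.prod_nonneg fun w _ => div_nonneg (pow_nonneg (hy w) _) (Nat.cast_nonneg _)

theorem edgeWeight_smul {r : ℕ} {W : Type*} [Fintype W] [DecidableEq W] (c : ℝ) (y : W → ℝ)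
    (e : Sym W r) : edgeWeight (c • y) e = c ^ r * edgeWeight y e := by
  have hsum : ∑ w : W, (e : Multiset W).count w = r := by
    rw [Multiset.sum_count_eq_card (fun w _ => Finset.mem_univ w)]; exact e.2
  unfold edgeWeight
  simp only [Pi.smul_apply, smul_eq_mul, mul_pow, mul_div_assoc]
  rw [Finset.prod_mul_distrib, Finset.prod_pow_eq_pow_sum, hsum]

/-- The weight of an edge without repeated vertices. -/
theorem edgeWeight_of_val_eq {r : ℕ} {W : Type*} [Fintype W] [DecidableEq W] (y : W → ℝ)
    (e : Sym W r) (S : Finset W) (h : (e : Multiset W) = S.val) :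
    edgeWeight y e = ∏ w ∈ S, y w := by
  unfold edgeWeight
  rw [h, ← Finset.prod_subset (Finset.subset_univ S)]
  · refine Finset.prod_congr rfl fun w hw => ?_
    rw [Multiset.count_eq_one_of_mem S.nodup (by simpa using hw)]
    simp
  · intro w _ hw
    rw [Multiset.count_eq_zero_of_notMem (by simpa using hw)]
    simp

theorem bddAbove_weight_image {r : ℕ} {W : Type*} [Fintype W] [DecidableEq W] (P : Pattern r W) :
    BddAbove (P.weight '' stdSimplex ℝ W) := by
  have hc : ContinuousOn P.weight (stdSimplex ℝ W) := by
    apply Continuous.continuousOn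
    unfold weight edgeWeight
    fun_prop
  exact ((isCompact_stdSimplex ℝ W).image_of_continuousOn hc).bddAbove

theorem weight_le_lagrangian {r : ℕ} {W : Type*} [Fintype W] [DecidableEq W] (P : Pattern r W)
    {w : W → ℝ} (hw : w ∈ stdSimplex ℝ W) : P.weight w ≤ P.lagrangian :=
  le_csSup P.bddAbove_weight_image ⟨w, hw, rfl⟩

/-- Homogeneity extends the bound by the Lagrangian to all nonnegative functions. -/
theorem weight_le_sum_pow_mul_lagrangian {r : ℕ} {W : Type*} [Fintype W] [DecidableEq W]
    (P : Pattern r W) {x : W → ℝ} (hx : ∀ w, 0 ≤ x w) (hpos : 0 < ∑ w, x w) :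
    P.weight x ≤ (∑ w, x w) ^ r * P.lagrangian := by
  set s := ∑ w, x w with hs
  have h1 : s⁻¹ • x ∈ stdSimplex ℝ W := by
    refine ⟨fun w => mul_nonneg (inv_nonneg.2 hpos.le) (hx w), ?_⟩
    simp only [Pi.smul_apply, smul_eq_mul]
    rw [← Finset.mul_sum, ← hs, inv_mul_cancel₀ hpos.ne']
  have h2 : P.weight x = s ^ r * P.weight (s⁻¹ • x) := by
    unfold weight
    rw [Finset.mul_sum]
    refine Finset.sum_congr rfl fun e _ => ?_
    rw [← edgeWeight_smul, smul_inv_smul₀ hpos.ne']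
  rw [h2]
  exact mul_le_mul_of_nonneg_left (P.weight_le_lagrangian h1) (by positivity)

/-- The push-forward of a weight function along a map of vertices. -/
def pushforward {W W' : Type*} [Fintype W] [DecidableEq W'] (φ : W → W') (x : W → ℝ)
    (w' : W') : ℝ :=
  ∑ w with φ w = w', x w

theorem pushforward_nonneg {W W' : Type*} [Fintype W] [DecidableEq W'] (φ : W → W') {x : W → ℝ}
    (hx : ∀ w, 0 ≤ x w) (w' : W') : 0 ≤ pushforward φ x w' :=
  Finset.sum_nonneg fun w _ => hx w

theorem sum_pushforward {W W' : Type*} [Fintype W] [Fintype W'] [DecidableEq W'] (φ : W → W')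
    (x : W → ℝ) : ∑ w', pushforward φ x w' = ∑ w, x w :=
  Finset.sum_fiberwise _ _ _

/-- Weights do not decrease under a homomorphism, if vertex weights are pushed forward. -/
theorem sum_edgeWeight_le_pushforward {r : ℕ} {W W' : Type*} [Fintype W] [DecidableEq W]
    [Fintype W'] [DecidableEq W'] (φ : W → W') {x : W → ℝ} (hx : ∀ w, 0 ≤ x w)
    (E : Finset (Sym W r)) (E' : Finset (Sym W' r)) (h : ∀ e ∈ E, e.map φ ∈ E') :
    ∑ e ∈ E, edgeWeight x e ≤ ∑ e ∈ E', edgeWeight (pushforward φ x) e := by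
  have hr : (0 : ℝ) < r.factorial := by positivity
  rw [← mul_le_mul_iff_right₀ hr, ← sum_tuples_eq (Fintype.card_fin r),
    ← sum_tuples_eq (Fintype.card_fin r)]
  have h1 : ∀ k : Fin r → W', ∏ i, pushforward φ x (k i)
      = ∑ g : Fin r → W with φ ∘ g = k, ∏ i, x (g i) := by
    intro k
    unfold pushforward
    rw [Finset.prod_univ_sum]
    refine Finset.sum_congr ?_ fun _ _ => rfl
    ext g
    simp [Fintype.mem_piFinset, funext_iff]
  have h2 : (∑ k : Fin r → W', if tupleSym (Fintype.card_fin r) k ∈ E' then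
      ∏ i, pushforward φ x (k i) else 0)
      = ∑ g : Fin r → W, if tupleSym (Fintype.card_fin r) (φ ∘ g) ∈ E' then
        ∏ i, x (g i) else 0 := by
    rw [← Finset.sum_fiberwise Finset.univ (fun g : Fin r → W => φ ∘ g)]
    refine Finset.sum_congr rfl fun k _ => ?_
    rw [h1]
    split_ifs with hk
    · refine Finset.sum_congr rfl fun g hg => ?_
      rw [(Finset.mem_filter.1 hg).2, if_pos hk]
    · symm
      refine Finset.sum_eq_zero fun g hg => ?_
      rw [(Finset.mem_filter.1 hg).2, if_neg hk]
  rw [h2]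
  refine Finset.sum_le_sum fun g _ => ?_
  split_ifs with h3 h4 h4
  · exact le_rfl
  · exact absurd (by rw [tupleSym_comp]; exact h _ h3) h4
  · exact Finset.prod_nonneg fun i _ => hx _
  · exact le_rfl

end Pattern

namespace Pattern

/-! ### Random blow-ups -/

/-- The `r`-subsets of a finite type whose image under `f`, as a multiset, belongs to `E`. -/
def pullback {r : ℕ} {α W : Type*} [Fintype α] [DecidableEq W] (f : α → W)
    (E : Finset (Sym W r)) : Finset (Finset α) :=
  (Finset.univ.powersetCard r).filter fun S => ∃ e ∈ E, (e : Multiset W) = S.val.map f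

/-- If the vertices of a set of size `r` are sent to `W` independently with distribution `y`, then
its image belongs to `E` with probability `r!` times the weight of `E`. -/
theorem sum_prod_mul_indicator_pullback {r : ℕ} {α W : Type*} [Fintype α] [DecidableEq α]
    [Fintype W] [DecidableEq W] (E : Finset (Sym W r)) {y : W → ℝ} (hy : ∑ w, y w = 1)
    (S : Finset α) (hS : S.card = r) :
    (∑ f : α → W, if S ∈ pullback f E then ∏ i, y (f i) else 0)
      = r.factorial * ∑ e ∈ E, edgeWeight y e := by
  have hι : Fintype.card {i // i ∈ S} = r := by simpa using hS
  rw [← sum_tuples_eq hι]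
  have h1 : ∀ f : α → W, (if S ∈ pullback f E then ∏ i, y (f i) else 0)
      = (if tupleSym hι (fun i : {i // i ∈ S} => f i) ∈ E then
          ∏ i : {i // i ∈ S}, y (f i) else 0) * ∏ i : {i // i ∉ S}, y (f i) := by
    intro f
    have hm : ((tupleSym hι fun i : {i // i ∈ S} => f i : Sym W r) : Multiset W)
        = S.val.map f := by
      simp only [tupleSym, Sym.coe_mk, Finset.univ_eq_attach, Finset.attach_val]
      exact Multiset.attach_map_val' _ _
    have : S ∈ pullback f E ↔ tupleSym hι (fun i : {i // i ∈ S} => f i) ∈ E := by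
      simp only [pullback, Finset.mem_filter, Finset.mem_powersetCard, Finset.subset_univ,
        true_and, hS]
      constructor
      · rintro ⟨e, he, h⟩
        rwa [show tupleSym hι (fun i : {i // i ∈ S} => f i) = e from
          Subtype.ext (hm.trans h.symm)]
      · exact fun h => ⟨_, h, hm⟩
    simp only [this]
    split_ifs
    · convert! (Fintype.prod_subtype_mul_prod_subtype (· ∈ S) fun i => y (f i)).symm
    · simp
  rw [Finset.sum_congr rfl fun f _ => h1 f]
  refine ((Equiv.piEquivPiSubtypeProd (· ∈ S) fun _ => W).sum_comp
    (fun p => (if tupleSym hι p.1 ∈ E then ∏ i, y (p.1 i) else 0) * ∏ i, y (p.2 i))).trans ?_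
  rw [Fintype.sum_prod_type]
  refine Finset.sum_congr rfl fun h _ => ?_
  have h2 : ∑ k : {i // i ∉ S} → W, ∏ i, y (k i) = 1 := by
    have := Finset.prod_univ_sum (fun _ : {i // i ∉ S} => (Finset.univ : Finset W))
      (fun _ w => y w)
    simpa [hy] using this.symm
  calc _ = ∑ k : {i // i ∉ S} → W,
        (if tupleSym hι h ∈ E then ∏ i, y (h i) else 0) * ∏ i, y (k i) := rfl
    _ = _ := by rw [← Finset.mul_sum, h2, mul_one]

/-- Some blow-up has at least the expected number of edges of a random one. -/
theorem exists_card_pullback_ge {r : ℕ} {α W : Type*} [Fintype α] [DecidableEq α]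
    [Fintype W] [DecidableEq W] (E : Finset (Sym W r)) {y : W → ℝ} (hy : y ∈ stdSimplex ℝ W) :
    ∃ f : α → W, ((Fintype.card α).choose r : ℝ) * (r.factorial * ∑ e ∈ E, edgeWeight y e)
      ≤ ((pullback f E).card : ℝ) := by
  by_contra! hcon
  set c := ((Fintype.card α).choose r : ℝ) * (r.factorial * ∑ e ∈ E, edgeWeight y e) with hc
  have htot : ∑ f : α → W, ∏ i, y (f i) = 1 := by
    have := Finset.prod_univ_sum (fun _ : α => (Finset.univ : Finset W)) (fun _ w => y w)
    simpa [hy.2] using this.symm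
  have hE : ∑ f : α → W, (∏ i, y (f i)) * ((pullback f E).card : ℝ) = c := by
    have h1 : ∀ f : α → W, (∏ i, y (f i)) * ((pullback f E).card : ℝ)
        = ∑ S ∈ Finset.univ.powersetCard r, if S ∈ pullback f E then ∏ i, y (f i) else 0 := by
      intro f
      rw [← Finset.sum_filter, Finset.sum_const, nsmul_eq_mul, mul_comm]
      congr 3
      ext S
      simp only [pullback, Finset.mem_filter]
      tauto
    rw [Finset.sum_congr rfl fun f _ => h1 f, Finset.sum_comm,
      Finset.sum_congr rfl fun S hS =>
        sum_prod_mul_indicator_pullback E hy.2 S (Finset.mem_powersetCard.1 hS).2,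
      Finset.sum_const, Finset.card_powersetCard, nsmul_eq_mul, Finset.card_univ]
  have hp : ∀ f : α → W, 0 ≤ ∏ i, y (f i) := fun f => Finset.prod_nonneg fun i _ => hy.1 _
  have hlt : ∑ f : α → W, (∏ i, y (f i)) * ((pullback f E).card : ℝ)
      < ∑ f : α → W, (∏ i, y (f i)) * c := by
    obtain ⟨f, _, hf⟩ : ∃ f ∈ (Finset.univ : Finset (α → W)), 0 < ∏ i, y (f i) := by
      apply Finset.exists_lt_of_sum_lt (f := fun _ => (0 : ℝ))
      rw [htot]
      simp
    exact Finset.sum_lt_sum (fun f _ => mul_le_mul_of_nonneg_left (hcon f).le (hp f))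
      ⟨f, Finset.mem_univ f, mul_lt_mul_of_pos_left (hcon f) hf⟩
  rw [hE, ← Finset.sum_mul, htot, one_mul] at hlt
  exact lt_irrefl _ hlt

end Pattern

/-! ### Locally sparse hypergraphs -/

/-- The edges of `A` that are contained in `U`. -/
def edgesInside {α : Type*} [DecidableEq α] (A : Finset (Finset α)) (U : Finset α) :
    Finset (Finset α) :=
  A.filter (· ⊆ U)

theorem card_filter_forall_eq_mul {α β : Type*} [Fintype α] [DecidableEq α] [Fintype β]
    [DecidableEq β] (z : β) (F : Finset α) :
    (Finset.univ.filter fun f : α → β => ∀ a ∈ F, f a = z).card * Fintype.card β ^ F.card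
      = Fintype.card β ^ Fintype.card α := by
  have h : (Finset.univ.filter fun f : α → β => ∀ a ∈ F, f a = z)
      = Fintype.piFinset fun a => if a ∈ F then {z} else Finset.univ := by
    ext f
    simp only [Finset.mem_filter, Finset.mem_univ, true_and, Fintype.mem_piFinset]
    refine forall_congr' fun a => ?_
    split_ifs with ha <;> simp [ha]
  rw [h, Fintype.card_piFinset]
  have h2 : ∀ a, (if a ∈ F then ({z} : Finset β) else Finset.univ).card
      = if a ∈ F then 1 else Fintype.card β := by
    intro a
    split_ifs <;> simp
  simp only [h2]
  rw [Finset.prod_ite, Finset.prod_const_one, one_mul, Finset.prod_const, ← pow_add,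
    Finset.filter_not, ← Finset.card_univ, Finset.filter_univ_mem,
    Finset.card_sdiff_add_card_eq_card (Finset.subset_univ F)]
  simp

/-- The deletion method: colour `α` at random with `q` colours, keep the elements of `S` that have
a given colour, and delete one element from each monochromatic `F b` of this colour. -/
theorem exists_subset_card_ge_of_deletion {α κ : Type*} [Fintype α] [DecidableEq α]
    (S : Finset α) (B : Finset κ) (F : κ → Finset α) (hF : ∀ b ∈ B, (F b).Nonempty)
    {q : ℕ} (hq : 0 < q) :
    ∃ A ⊆ S, (∀ b ∈ B, ¬ F b ⊆ A) ∧
      (S.card : ℝ) / q - ∑ b ∈ B, 1 / (q : ℝ) ^ (F b).card ≤ A.card := by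
  classical
  -- `z` is the chosen colour, `A₀ f` are the elements of that colour, and `D f` are the
  -- monochromatic sets of that colour.
  let z : Fin q := ⟨0, hq⟩
  have hq' : (0 : ℝ) < q := by exact_mod_cast hq
  set M : ℝ := (q : ℝ) ^ Fintype.card α with hM
  have hMpos : 0 < M := by positivity
  have hcount : ∀ G : Finset α,
      ((Finset.univ.filter fun f : α → Fin q => ∀ a ∈ G, f a = z).card : ℝ)
        = M * (1 / (q : ℝ) ^ G.card) := by
    intro G
    have h : ((Finset.univ.filter fun f : α → Fin q => ∀ a ∈ G, f a = z).card : ℝ)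
        * (q : ℝ) ^ G.card = M := by
      have := card_filter_forall_eq_mul z G
      rw [hM]
      rw [Fintype.card_fin] at this
      exact_mod_cast this
    rw [← h]
    field_simp
  let D : (α → Fin q) → Finset κ := fun f => B.filter fun b => ∀ a ∈ F b, f a = z
  let A₀ : (α → Fin q) → Finset α := fun f => S.filter fun a => f a = z
  have h1 : ∑ f : α → Fin q, ((A₀ f).card : ℝ) = M * (S.card / q) := by
    have : ∀ f : α → Fin q, ((A₀ f).card : ℝ) = ∑ a ∈ S, if f a = z then (1 : ℝ) else 0 := by
      intro f
      simp [A₀]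
    rw [Finset.sum_congr rfl fun f _ => this f, Finset.sum_comm]
    have h2 : ∀ a ∈ S, (∑ f : α → Fin q, if f a = z then (1 : ℝ) else 0) = M * (1 / q) := by
      intro a _
      have := hcount {a}
      simpa using this
    rw [Finset.sum_congr rfl h2, Finset.sum_const, nsmul_eq_mul]
    ring
  have h2 : ∑ f : α → Fin q, ((D f).card : ℝ) = M * ∑ b ∈ B, 1 / (q : ℝ) ^ (F b).card := by
    have : ∀ f : α → Fin q, ((D f).card : ℝ)
        = ∑ b ∈ B, if ∀ a ∈ F b, f a = z then (1 : ℝ) else 0 := by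
      intro f
      simp [D]
    rw [Finset.sum_congr rfl fun f _ => this f, Finset.sum_comm, Finset.mul_sum]
    refine Finset.sum_congr rfl fun b _ => ?_
    rw [← hcount (F b)]
    simp
  obtain ⟨f, -, hf⟩ : ∃ f ∈ (Finset.univ : Finset (α → Fin q)),
      (S.card : ℝ) / q - ∑ b ∈ B, 1 / (q : ℝ) ^ (F b).card ≤ (A₀ f).card - (D f).card := by
    apply Finset.exists_le_of_sum_le ⟨fun _ => z, Finset.mem_univ _⟩
    rw [Finset.sum_sub_distrib (fun f => ((A₀ f).card : ℝ)), h1, h2, Finset.sum_const,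
      Finset.card_univ, Fintype.card_fun,
      Fintype.card_fin, nsmul_eq_mul, Nat.cast_pow, ← hM, mul_sub]
  have hT : ∀ b, ∃ T : Finset α, T.card ≤ 1 ∧ (b ∈ B → ∃ a ∈ F b, a ∈ T) := by
    intro b
    by_cases hb : b ∈ B
    · obtain ⟨a, ha⟩ := hF b hb
      exact ⟨{a}, by simp, fun _ => ⟨a, ha, by simp⟩⟩
    · exact ⟨∅, by simp, fun h => absurd h hb⟩
  -- Delete from `A₀ f` an element of each monochromatic set.
  choose T hT1 hT2 using hT
  refine ⟨A₀ f \ (D f).biUnion T, fun a ha => ?_, fun b hb hsub => ?_, hf.trans ?_⟩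
  · exact (Finset.mem_filter.1 (Finset.mem_sdiff.1 ha).1).1
  · have hbD : b ∈ D f := Finset.mem_filter.2 ⟨hb, fun a ha =>
      (Finset.mem_filter.1 (Finset.mem_sdiff.1 (hsub ha)).1).2⟩
    obtain ⟨a, haF, haT⟩ := hT2 b hb
    exact (Finset.mem_sdiff.1 (hsub haF)).2 (Finset.mem_biUnion.2 ⟨b, hbD, haT⟩)
  · have h3 := Finset.le_card_sdiff ((D f).biUnion T) (A₀ f)
    have h4 : ((D f).biUnion T).card ≤ (D f).card := by
      simpa using Finset.card_biUnion_le_card_mul (D f) T 1 fun b _ => hT1 b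
    have h5 : (A₀ f).card ≤ (A₀ f \ (D f).biUnion T).card + (D f).card := by omega
    have : ((A₀ f).card : ℝ) ≤ (A₀ f \ (D f).biUnion T).card + (D f).card := by exact_mod_cast h5
    linarith

/-- For every constant `c` there are `r`-graphs on `t` vertices with at least `c t ^ (r - 1)` edges
in which at most `u - (r - 1)` edges are spanned by any `u` vertices, if `r - 1 ≤ u ≤ k`. -/
theorem exists_locally_sparse (d k c : ℕ) :
    ∃ t : ℕ, 0 < t ∧ k ≤ t ∧ ∃ A : Finset (Finset (Fin t)), (∀ S ∈ A, S.card = d + 1) ∧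
      (c : ℝ) * (t : ℝ) ^ d ≤ A.card ∧
      ∀ U : Finset (Fin t), U.card ≤ k → d ≤ U.card → (edgesInside A U).card + d ≤ U.card := by
  -- The colour probability is `1 / q`, and `t = c₀ q`. Then the expected number of edges is at
  -- least `(c + 1) t ^ d`, and that of dense sets at most `K q ^ (d - 1) ≤ t ^ d`.
  set c₀ : ℕ := 2 ^ (d + 1) * (d + 1).factorial * (c + 1) with hc₀
  have hc₀pos : 0 < c₀ := by positivity
  set K : ℕ := ∑ i ∈ Finset.range (k + 1),
    c₀ ^ (d + 1 + i) * ((d + 1 + i).choose (d + 1)).choose (i + 2) with hK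
  set q : ℕ := K + 2 * (d + 1) + k with hq
  have hqpos : 0 < q := by omega
  set t : ℕ := c₀ * q with ht
  have hqt : q ≤ t := Nat.le_mul_of_pos_left q hc₀pos
  refine ⟨t, by omega, by omega, ?_⟩
  let B : Finset (Σ _ : ℕ, Σ _ : Finset (Fin t), Finset (Finset (Fin t))) :=
    (Finset.range (k + 1)).sigma fun i =>
      ((Finset.univ : Finset (Fin t)).powersetCard (d + 1 + i)).sigma fun U =>
        (U.powersetCard (d + 1)).powersetCard (i + 2)
  obtain ⟨A, hAS, hAB, hA⟩ := exists_subset_card_ge_of_deletion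
    ((Finset.univ : Finset (Fin t)).powersetCard (d + 1)) B (fun b => b.2.2) (by
      rintro ⟨i, U, F⟩ hb
      simp only [B, Finset.mem_sigma, Finset.mem_powersetCard] at hb
      rw [← Finset.card_pos]
      dsimp only
      omega) hqpos
  have hAcard : ∀ S ∈ A, S.card = d + 1 := fun S hS => (Finset.mem_powersetCard.1 (hAS hS)).2
  refine ⟨A, hAcard, le_trans ?_ hA, fun U hUk hdU => ?_⟩
  · have hq0 : (0 : ℝ) < q := by exact_mod_cast hqpos
    have htq : (t : ℝ) = c₀ * q := by rw [ht]; push_cast; ring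
    have hBsum : ∑ b ∈ B, 1 / (q : ℝ) ^ b.2.2.card ≤ (t : ℝ) ^ d := by
      have h1 : ∑ b ∈ B, 1 / (q : ℝ) ^ b.2.2.card
          = ∑ i ∈ Finset.range (k + 1), (t.choose (d + 1 + i) : ℝ)
            * (((d + 1 + i).choose (d + 1)).choose (i + 2) * (1 / (q : ℝ) ^ (i + 2))) := by
        simp only [B]
        rw [Finset.sum_sigma]
        refine Finset.sum_congr rfl fun i _ => ?_
        rw [Finset.sum_sigma]
        have h2 : ∀ U ∈ (Finset.univ : Finset (Fin t)).powersetCard (d + 1 + i),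
            ∑ F ∈ (U.powersetCard (d + 1)).powersetCard (i + 2), 1 / (q : ℝ) ^ F.card
            = ((d + 1 + i).choose (d + 1)).choose (i + 2) * (1 / (q : ℝ) ^ (i + 2)) := by
          intro U hU
          rw [Finset.sum_congr rfl fun F hF => by rw [(Finset.mem_powersetCard.1 hF).2],
            Finset.sum_const, nsmul_eq_mul, Finset.card_powersetCard, Finset.card_powersetCard,
            (Finset.mem_powersetCard.1 hU).2]
        rw [Finset.sum_congr rfl h2, Finset.sum_const, nsmul_eq_mul, Finset.card_powersetCard,
          Finset.card_univ, Fintype.card_fin]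
      have h3 : ∀ i ∈ Finset.range (k + 1), (t.choose (d + 1 + i) : ℝ)
            * (((d + 1 + i).choose (d + 1)).choose (i + 2) * (1 / (q : ℝ) ^ (i + 2)))
          ≤ (c₀ ^ (d + 1 + i) * ((d + 1 + i).choose (d + 1)).choose (i + 2) : ℕ)
            * ((q : ℝ) ^ d / q) := by
        intro i _
        have h4 : (t.choose (d + 1 + i) : ℝ) ≤ (c₀ * q : ℝ) ^ (d + 1 + i) := by
          rw [← htq]
          exact_mod_cast Nat.choose_le_pow t (d + 1 + i)
        refine (mul_le_mul_of_nonneg_right h4 (by positivity)).trans_eq ?_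
        push_cast
        rw [mul_pow]
        field_simp
        ring
      rw [h1]
      refine (Finset.sum_le_sum h3).trans ?_
      rw [← Finset.sum_mul, ← Nat.cast_sum, ← hK]
      have h5 : (K : ℝ) ≤ q := by exact_mod_cast (by omega : K ≤ q)
      calc (K : ℝ) * ((q : ℝ) ^ d / q) ≤ q * ((q : ℝ) ^ d / q) := by gcongr
        _ = (q : ℝ) ^ d := by field_simp
        _ ≤ (t : ℝ) ^ d := by
            have : (q : ℝ) ≤ t := by exact_mod_cast hqt
            gcongr
    have hmain : ((c : ℝ) + 1) * (t : ℝ) ^ d ≤ (t.choose (d + 1) : ℝ) / q := by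
      have h1 := Nat.pow_le_choose (α := ℝ) (d + 1) t
      have h2 : (t : ℝ) / 2 ≤ ((t + 1 - (d + 1) : ℕ) : ℝ) := by
        have : t ≤ 2 * (t + 1 - (d + 1)) := by omega
        have : (t : ℝ) ≤ 2 * ((t + 1 - (d + 1) : ℕ) : ℝ) := by exact_mod_cast this
        linarith
      have h3 : ((t : ℝ) / 2) ^ (d + 1) / (d + 1).factorial ≤ t.choose (d + 1) :=
        le_trans (by gcongr) h1
      rw [le_div_iff₀ hq0]
      refine le_trans (le_of_eq ?_) h3
      rw [div_pow, pow_succ (t : ℝ) d]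
      nth_rewrite 3 [htq]
      rw [hc₀]
      push_cast
      field_simp
    rw [Finset.card_powersetCard, Finset.card_univ, Fintype.card_fin]
    linarith
  · -- A violating set would contain one of the deleted configurations `B`, or, if it has only
    -- `d` vertices, an edge of size `d + 1`.
    by_contra! hlt
    rcases Nat.eq_or_lt_of_le hdU with hU | hU
    · obtain ⟨S, hS⟩ : (edgesInside A U).Nonempty := by
        rw [← Finset.card_pos]
        omega
      obtain ⟨hSA, hSU⟩ := Finset.mem_filter.1 hS
      have := Finset.card_le_card hSU
      rw [hAcard S hSA] at this
      omega
    · obtain ⟨i, hi⟩ : ∃ i, U.card = d + 1 + i := ⟨U.card - (d + 1), by omega⟩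
      obtain ⟨F, hFA, hF⟩ := Finset.exists_subset_card_eq (n := i + 2)
        (s := edgesInside A U) (by omega)
      refine hAB ⟨i, U, F⟩ ?_ fun S hS => (Finset.mem_filter.1 (hFA hS)).1
      simp only [B, Finset.mem_sigma, Finset.mem_powersetCard, Finset.mem_range]
      refine ⟨by omega, ⟨Finset.subset_univ _, hi⟩, fun S hS => ?_, hF⟩
      obtain ⟨hSA, hSU⟩ := Finset.mem_filter.1 (hFA hS)
      exact Finset.mem_powersetCard.2 ⟨hSU, hAcard S hSA⟩

/-- In a locally sparse `(d + 1)`-graph the total weight of the edges is at most that of the edges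
`R ∪ {i}`, `i ∉ R`, where `R` is a set of `d` heaviest vertices. The vertices are added in order of
decreasing weight. The term with `m` records the number of further edges that local sparsity would
allow, none of which can weigh more than `(∏ i ∈ R, x i) * m` once all new vertices weigh at most
`m`. -/
theorem exists_sum_prod_add_slack_le {α : Type*} [DecidableEq α] {d : ℕ} {A : Finset (Finset α)}
    (hA : ∀ S ∈ A, S.card = d + 1) {x : α → ℝ} (hx : ∀ i, 0 ≤ x i) (U : Finset α)
    (hsp : ∀ U' ⊆ U, d ≤ U'.card → (edgesInside A U').card + d ≤ U'.card) (hU : d ≤ U.card) :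
    ∃ R ⊆ U, R.card = d ∧ (∀ T ⊆ U, T.card = d → ∏ i ∈ T, x i ≤ ∏ i ∈ R, x i) ∧
      ∀ m : ℝ, 0 ≤ m → (∀ i ∈ U, m ≤ x i) →
        (∑ S ∈ edgesInside A U, ∏ i ∈ S, x i)
          + ((U.card : ℝ) - d - (edgesInside A U).card) * ((∏ i ∈ R, x i) * m)
          ≤ (∏ i ∈ R, x i) * ∑ i ∈ U \ R, x i := by
  have hbase : ∀ U : Finset α, U.card = d →
      (∀ U' ⊆ U, d ≤ U'.card → (edgesInside A U').card + d ≤ U'.card) →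
      ∃ R ⊆ U, R.card = d ∧ (∀ T ⊆ U, T.card = d → ∏ i ∈ T, x i ≤ ∏ i ∈ R, x i) ∧
      ∀ m : ℝ, 0 ≤ m → (∀ i ∈ U, m ≤ x i) →
        (∑ S ∈ edgesInside A U, ∏ i ∈ S, x i)
          + ((U.card : ℝ) - d - (edgesInside A U).card) * ((∏ i ∈ R, x i) * m)
          ≤ (∏ i ∈ R, x i) * ∑ i ∈ U \ R, x i := by
    intro U hU hsp
    have h0 : edgesInside A U = ∅ := by
      rw [← Finset.card_eq_zero]
      have := hsp U subset_rfl hU.ge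
      omega
    refine ⟨U, subset_rfl, hU, fun T hT hTd => ?_, fun m _ _ => ?_⟩
    · rw [Finset.eq_of_subset_of_card_le hT (by omega)]
    · simp [h0, hU]
  induction U using Finset.induction_on_min_value x with
  | empty => exact hbase ∅ (by simp at hU; simp [hU]) hsp
  | insert j U hj hmin ih =>
    rw [Finset.card_insert_of_notMem hj] at hU
    rcases Nat.eq_or_lt_of_le hU with hU' | hU'
    · exact hbase _ (by rw [Finset.card_insert_of_notMem hj]; exact hU'.symm) hsp
    · have hdU : d ≤ U.card := by omega
      have hsp' := fun U' (h : U' ⊆ U) => hsp U' (h.trans (Finset.subset_insert j U))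
      obtain ⟨R, hRU, hRd, hRmax, hR⟩ := ih hsp' hdU
      have hjR : j ∉ R := fun h => hj (hRU h)
      set ρ : ℝ := ∏ i ∈ R, x i with hρ
      have hρ0 : 0 ≤ ρ := Finset.prod_nonneg fun i _ => hx i
      refine ⟨R, hRU.trans (Finset.subset_insert j U), hRd, fun T hT hTd => ?_,
        fun m hm0 hm => ?_⟩
      · -- Replacing `j` by a heavier vertex outside `T` does not decrease the product.
        by_cases hjT : j ∈ T
        · have hT'U : T.erase j ⊆ U := fun i hi => by
            have := hT (Finset.mem_of_mem_erase hi)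
            exact (Finset.mem_insert.1 this).resolve_left (Finset.ne_of_mem_erase hi)
          have hc := Finset.card_erase_add_one hjT
          obtain ⟨i, hiU, hiT⟩ := Finset.exists_mem_notMem_of_card_lt_card
            (show (T.erase j).card < U.card by omega)
          have h1 := hRmax (insert i (T.erase j)) (Finset.insert_subset hiU hT'U)
            (by rw [Finset.card_insert_of_notMem hiT]; omega)
          rw [Finset.prod_insert hiT] at h1
          rw [← Finset.mul_prod_erase T x hjT]
          exact le_trans (mul_le_mul_of_nonneg_right (hmin i hiU)
            (Finset.prod_nonneg fun i _ => hx i)) h1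
        · exact hRmax T ((Finset.subset_insert_iff_of_notMem hjT).1 hT) hTd
      · have h1 := hR (x j) (hx j) hmin
        have hsub : edgesInside A U ⊆ edgesInside A (insert j U) :=
          Finset.monotone_filter_right A fun S _ h => h.trans (Finset.subset_insert j U)
        set N := edgesInside A (insert j U) \ edgesInside A U with hN
        have hNle : ∑ S ∈ N, ∏ i ∈ S, x i ≤ N.card * (ρ * x j) := by
          rw [← nsmul_eq_mul]
          refine Finset.sum_le_card_nsmul _ _ _ fun S hS => ?_
          obtain ⟨hS1, hS2⟩ := Finset.mem_sdiff.1 hS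
          obtain ⟨hSA, hSU⟩ := Finset.mem_filter.1 hS1
          have hjS : j ∈ S := by
            by_contra h
            exact hS2 (Finset.mem_filter.2
              ⟨hSA, (Finset.subset_insert_iff_of_notMem h).1 hSU⟩)
          rw [← Finset.prod_erase_mul S x hjS]
          refine mul_le_mul_of_nonneg_right (hRmax _ ?_ ?_) (hx j)
          · exact Finset.subset_insert_iff.1 hSU
          · rw [Finset.card_erase_of_mem hjS, hA S hSA, Nat.add_sub_cancel]
        have hcard : ((edgesInside A (insert j U)).card : ℝ)
            = N.card + (edgesInside A U).card := by
          exact_mod_cast (Finset.card_sdiff_add_card_eq_card hsub).symm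
        have hsum := Finset.sum_sdiff (f := fun S => ∏ i ∈ S, x i) hsub
        have hslack := hsp _ subset_rfl (by rw [Finset.card_insert_of_notMem hj]; omega)
        rw [Finset.card_insert_of_notMem hj] at hslack
        have hslack' : ((edgesInside A (insert j U)).card : ℝ) + d ≤ U.card + 1 := by
          exact_mod_cast hslack
        have hmj : ρ * m ≤ ρ * x j :=
          mul_le_mul_of_nonneg_left (hm j (Finset.mem_insert_self j U)) hρ0
        rw [← hsum, Finset.card_insert_of_notMem hj, Finset.insert_sdiff_of_notMem _ hjR,
          Finset.sum_insert (by simp [hj])]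
        rw [hcard] at hslack' ⊢
        push_cast
        have h2 := mul_le_mul_of_nonneg_left hmj
          (show (0 : ℝ) ≤ (U.card : ℝ) + 1 - d - (N.card + (edgesInside A U).card) by linarith)
        linarith

/-- The bound of `exists_sum_prod_add_slack_le` without the slack term. -/
theorem exists_sum_prod_le {α : Type*} [DecidableEq α] {d : ℕ} {A : Finset (Finset α)}
    (hA : ∀ S ∈ A, S.card = d + 1) {x : α → ℝ} (hx : ∀ i, 0 ≤ x i) (U : Finset α)
    (hsp : ∀ U' ⊆ U, d ≤ U'.card → (edgesInside A U').card + d ≤ U'.card) (hU : d ≤ U.card) :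
    ∃ R ⊆ U, R.card = d ∧
      ∑ S ∈ edgesInside A U, ∏ i ∈ S, x i ≤ (∏ i ∈ R, x i) * ∑ i ∈ U \ R, x i := by
  obtain ⟨R, hRU, hRd, -, h⟩ := exists_sum_prod_add_slack_le hA hx U hsp hU
  exact ⟨R, hRU, hRd, by simpa using h 0 le_rfl fun i _ => hx i⟩

/-! ### Patterns obtained by adding a sparse hypergraph -/

/-- All but a proportion `(d + 1) ^ 2 / t` of the `(d + 1)`-tuples have distinct entries. -/
theorem pow_succ_le_descFactorial_add (t d : ℕ) :
    (t : ℝ) ^ (d + 1) ≤ t.descFactorial (d + 1) + ((d : ℝ) + 1) ^ 2 * (t : ℝ) ^ d := by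
  induction d with
  | zero => simp
  | succ d ih =>
    have h1 : (t : ℝ) ≤ ((t - (d + 1) : ℕ) : ℝ) + (d + 1) := by
      exact_mod_cast (by omega : t ≤ (t - (d + 1)) + (d + 1))
    have h2 : (t.descFactorial (d + 1) : ℝ) ≤ (t : ℝ) ^ (d + 1) := by
      exact_mod_cast Nat.descFactorial_le_pow t (d + 1)
    have h3 : (0 : ℝ) ≤ t.descFactorial (d + 1) := Nat.cast_nonneg _
    have h4 : (0 : ℝ) ≤ t := Nat.cast_nonneg _
    have h5 : (0 : ℝ) ≤ d := Nat.cast_nonneg _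
    rw [Nat.descFactorial_succ, Nat.cast_mul]
    have h6 := mul_le_mul_of_nonneg_right h1 h3
    have h7 := mul_le_mul_of_nonneg_right h2 (show (0 : ℝ) ≤ d + 1 by positivity)
    have h8 := mul_le_mul_of_nonneg_left ih h4
    have h9 : (0 : ℝ) ≤ (t : ℝ) ^ (d + 1) := by positivity
    push_cast
    have h10 : (t : ℝ) * (((d : ℝ) + 1) ^ 2 * (t : ℝ) ^ d)
        = ((d : ℝ) + 1) ^ 2 * (t : ℝ) ^ (d + 1) := by
      ring
    have h11 : (t : ℝ) ^ (d + 1 + 1) = t * (t : ℝ) ^ (d + 1) := by ring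
    nlinarith [mul_nonneg h5 h9]

namespace Pattern

/-- A set of subsets of `α`, regarded via `j : α ↪ W` as a set of multisets on `W`. -/
def embeddedEdges (r : ℕ) {α W : Type*} [Fintype W] [DecidableEq W] (j : α ↪ W)
    (A : Finset (Finset α)) : Finset (Sym W r) :=
  Finset.univ.filter fun e => ∃ S ∈ A, (e : Multiset W) = (S.map j).val

theorem sum_embeddedEdges {r : ℕ} {α W : Type*} [Fintype W] [DecidableEq W] (j : α ↪ W)
    {A : Finset (Finset α)} (hA : ∀ S ∈ A, S.card = r) (x : W → ℝ) :
    ∑ e ∈ embeddedEdges r j A, edgeWeight x e = ∑ S ∈ A, ∏ i ∈ S, x (j i) := by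
  symm
  refine Finset.sum_bij (fun S hS => (⟨(S.map j).val, by simpa using hA S hS⟩ : Sym W r))
    (fun S hS => ?_) (fun S hS S' hS' h => ?_) (fun e he => ?_) (fun S hS => ?_)
  · exact Finset.mem_filter.2 ⟨Finset.mem_univ _, S, hS, rfl⟩
  · exact Finset.map_injective j (Finset.val_injective (congrArg Subtype.val h))
  · obtain ⟨-, S, hS, h⟩ := Finset.mem_filter.1 he
    exact ⟨S, hS, Subtype.ext h.symm⟩
  · exact ((edgeWeight_of_val_eq x _ (S.map j) rfl).trans (Finset.prod_map S j x)).symm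

/-- The edges of the blow-up of `P` in which every vertex is replaced by `t` copies, without those
edges that use some index of a copy twice. -/
def spreadEdges {r : ℕ} {V : Type*} [Fintype V] [DecidableEq V] (P : Pattern r V) (t : ℕ) :
    Finset (Sym (V × Fin t) r) :=
  Finset.univ.filter fun e =>
    e.map Prod.fst ∈ P.edges ∧ ((e : Multiset (V × Fin t)).map Prod.snd).Nodup

/-- The copies of `v` in `V × Fin t`. -/
def copiesEmb {V : Type*} (v : V) (t : ℕ) : Fin t ↪ V × Fin t :=
  ⟨fun i => (v, i), fun _ _ h => congrArg Prod.snd h⟩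

/-- The pattern on `t` copies of each vertex of `P` that has the edges `spreadEdges P t` and the
edges of `A`, placed on the copies of `v`. -/
def sparseExtension {r : ℕ} {V : Type*} [Fintype V] [DecidableEq V] (P : Pattern r V) (v : V)
    {t : ℕ} (A : Finset (Finset (Fin t))) : Pattern r (V × Fin t) where
  edges := spreadEdges P t ∪ embeddedEdges r (copiesEmb v t) A

section

variable {r : ℕ} {V : Type*} [DecidableEq V]

/-- The index of the copy to which `foldMap` sends a vertex: the copies `(v, i)` with `i ∈ R` have
distinct nonzero indices, and all other vertices have index `0`. -/
noncomputable def foldIndex (v : V) {t d : ℕ} {R : Finset (Fin t)} (hR : R.card = d)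
    (p : V × Fin t) : ℕ :=
  if h : p.1 = v ∧ p.2 ∈ R then (R.equivFinOfCardEq hR ⟨p.2, h.2⟩ : ℕ) + 1 else 0

theorem foldIndex_lt (v : V) {t d : ℕ} {R : Finset (Fin t)} (hR : R.card = d) (p : V × Fin t) :
    foldIndex v hR p < frMult (d + 1) v p.1 := by
  unfold foldIndex frMult
  split_ifs with h h' h'
  · have := (R.equivFinOfCardEq hR ⟨p.2, h.2⟩).2
    omega
  · exact absurd h.1 h'
  · omega
  · omega

/-- The map from `V × Fin t` to the vertices of the Frankl–Rödl construction that forgets the index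
of a copy, except that the copies of `v` with index in `R` are sent to the copies
`(v, 1), …, (v, d)`, where the copies of `v` are numbered from `0`. -/
noncomputable def foldMap (v : V) {t d : ℕ} {R : Finset (Fin t)} (hR : R.card = d)
    (p : V × Fin t) : Σ u : V, Fin (frMult (d + 1) v u) :=
  ⟨p.1, ⟨foldIndex v hR p, foldIndex_lt v hR p⟩⟩

theorem eq_of_foldMap_eq {v : V} {t d : ℕ} {R : Finset (Fin t)} (hR : R.card = d)
    {i : Fin (frMult (d + 1) v v)} (hi : (i : ℕ) ≠ 0) {p p' : V × Fin t}
    (hp : foldMap v hR p = ⟨v, i⟩) (hp' : foldMap v hR p' = ⟨v, i⟩) : p = p' := by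
  have key : ∀ q : V × Fin t, foldMap v hR q = ⟨v, i⟩ → q.1 = v ∧ foldIndex v hR q = i := by
    rintro ⟨u, a⟩ hq
    have h1 : u = v := congrArg Sigma.fst hq
    subst h1
    refine ⟨rfl, ?_⟩
    have := eq_of_heq (Sigma.mk.inj hq).2
    exact congrArg Fin.val this
  obtain ⟨h1, h2⟩ := key p hp
  obtain ⟨h1', h2'⟩ := key p' hp'
  have h3 : foldIndex v hR p = foldIndex v hR p' := h2.trans h2'.symm
  rw [← h2] at hi
  have hi' := hi
  rw [h3] at hi'
  unfold foldIndex at h3 hi hi'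
  have hp := (Classical.not_not.1 fun h => hi (dif_neg h) : p.1 = v ∧ p.2 ∈ R)
  have hp' := (Classical.not_not.1 fun h => hi' (dif_neg h) : p'.1 = v ∧ p'.2 ∈ R)
  rw [dif_pos hp, dif_pos hp'] at h3
  have h4 := (R.equivFinOfCardEq hR).injective (Fin.ext (Nat.succ_injective h3))
  exact Prod.ext (h1.trans h1'.symm) (congrArg Subtype.val h4)

variable [Fintype V]

theorem disjoint_spreadEdges_embeddedEdges {P : Pattern r V} {v : V}
    (hv : Sym.replicate r v ∉ P.edges) {t : ℕ} (A : Finset (Finset (Fin t))) :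
    Disjoint (spreadEdges P t) (embeddedEdges r (copiesEmb v t) A) := by
  rw [Finset.disjoint_left]
  intro e he he'
  obtain ⟨-, h1, -⟩ := Finset.mem_filter.1 he
  obtain ⟨-, S, hS, h2⟩ := Finset.mem_filter.1 he'
  apply hv
  convert h1
  refine (Sym.eq_replicate.2 fun u hu => ?_).symm
  rw [Sym.mem_map] at hu
  obtain ⟨p, hp, rfl⟩ := hu
  have hp' : p ∈ (e : Multiset (V × Fin t)) := hp
  rw [h2] at hp'
  obtain ⟨i, -, rfl⟩ := Finset.mem_map.1 (Finset.mem_def.2 hp')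
  rfl

theorem card_filter_injective (r t : ℕ) :
    (Finset.univ.filter fun b : Fin r → Fin t => Function.Injective b).card
      = t.descFactorial r := by
  rw [← Fintype.card_subtype,
    Fintype.card_congr (Equiv.subtypeInjectiveEquivEmbedding (Fin r) (Fin t)),
    Fintype.card_embedding_eq, Fintype.card_fin, Fintype.card_fin]

/-- If the weight of each vertex is divided equally among its copies, then the part of `P (w)` that
remains is the probability that `r` random indices are distinct. -/
theorem sum_spreadEdges_edgeWeight (P : Pattern r V) (t : ℕ) (w : V → ℝ) :
    ∑ e ∈ spreadEdges P t, edgeWeight (fun p : V × Fin t => w p.1 / t) e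
      = P.weight w * (t.descFactorial r / (t : ℝ) ^ r) := by
  have hr : (r.factorial : ℝ) ≠ 0 := by positivity
  apply mul_left_cancel₀ hr
  unfold weight
  rw [← mul_assoc, ← sum_tuples_eq (Fintype.card_fin r), ← sum_tuples_eq (Fintype.card_fin r)]
  have h1 : ∀ g : Fin r → V × Fin t, tupleSym (Fintype.card_fin r) g ∈ spreadEdges P t ↔
      tupleSym (Fintype.card_fin r) (Prod.fst ∘ g) ∈ P.edges
        ∧ Function.Injective (Prod.snd ∘ g) := by
    intro g
    rw [tupleSym_comp]
    simp only [spreadEdges, Finset.mem_filter, Finset.mem_univ, true_and]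
    refine and_congr_right fun _ => ?_
    simp only [tupleSym, Sym.coe_mk, Multiset.map_map]
    rw [Finset.nodup_map_iff_injOn, Finset.coe_univ, Set.injOn_univ]
  rw [← card_filter_injective, Finset.card_filter, Nat.cast_sum, Finset.sum_div,
    Finset.sum_mul_sum, ← Fintype.sum_prod_type']
  refine Fintype.sum_equiv (Equiv.arrowProdEquivProdArrow (Fin r) (fun _ => V) fun _ => Fin t)
    _ _ fun g => ?_
  have h2 : (Equiv.arrowProdEquivProdArrow (Fin r) (fun _ => V) (fun _ => Fin t)) g
      = (Prod.fst ∘ g, Prod.snd ∘ g) := rfl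
  rw [h2]
  by_cases ha : tupleSym (Fintype.card_fin r) (Prod.fst ∘ g) ∈ P.edges
  · by_cases hb : Function.Injective (Prod.snd ∘ g)
    · rw [if_pos ((h1 g).2 ⟨ha, hb⟩), if_pos ha, if_pos hb, Finset.prod_div_distrib]
      simp [div_eq_mul_inv]
    · rw [if_neg fun h => hb ((h1 g).1 h).2, if_neg hb]
      simp
  · rw [if_neg fun h => ha ((h1 g).1 h).1, if_neg ha]
    simp

/-- Enough edges in `A` make up for the loss in passing from `P` to `spreadEdges P t`, which is of
relative order `1 / t`. -/
theorem weight_lt_weight_sparseExtension {d : ℕ} {P : Pattern (d + 1) V} {v : V}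
    (hvP : Sym.replicate (d + 1) v ∉ P.edges) {w : V → ℝ} (hw : ∀ u, 0 ≤ w u) {t : ℕ} (ht : 0 < t)
    {A : Finset (Finset (Fin t))} (hA : ∀ S ∈ A, S.card = d + 1) {c : ℝ}
    (hc : P.weight w * ((d : ℝ) + 1) ^ 2 < c * w v ^ (d + 1))
    (hcard : c * (t : ℝ) ^ d ≤ A.card) :
    P.weight w < (P.sparseExtension v A).weight (fun p : V × Fin t => w p.1 / t) := by
  have ht' : (0 : ℝ) < t := by exact_mod_cast ht
  have hP : 0 ≤ P.weight w := Finset.sum_nonneg fun e _ => edgeWeight_nonneg hw e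
  have h1 : (P.sparseExtension v A).weight (fun p : V × Fin t => w p.1 / t)
      = P.weight w * (t.descFactorial (d + 1) / (t : ℝ) ^ (d + 1))
        + A.card * (w v / t) ^ (d + 1) := by
    rw [weight, sparseExtension, Finset.sum_union (disjoint_spreadEdges_embeddedEdges hvP A),
      sum_spreadEdges_edgeWeight, sum_embeddedEdges _ hA]
    congr 1
    have : ∀ S ∈ A, (∏ i ∈ S, w (copiesEmb v t i).1 / t) = (w v / t) ^ (d + 1) := by
      intro S hS
      rw [← hA S hS]
      exact Finset.prod_const (w v / t)
    rw [Finset.sum_congr rfl this, Finset.sum_const, nsmul_eq_mul]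
  have hv : 0 ≤ w v ^ (d + 1) := pow_nonneg (hw v) _
  rw [h1, div_pow, mul_div_assoc', mul_div_assoc', ← add_div, lt_div_iff₀ (by positivity)]
  have h2 := mul_le_mul_of_nonneg_left (pow_succ_le_descFactorial_add t d) hP
  have h3 := mul_le_mul_of_nonneg_right hcard hv
  have h4 := mul_lt_mul_of_pos_right hc (show (0 : ℝ) < (t : ℝ) ^ d by positivity)
  linarith

theorem edgeWeight_frEdge (v : V) (y : (Σ u : V, Fin (frMult r v u)) → ℝ) :
    edgeWeight y (frEdge r v) = ∏ j : Fin (frMult r v v), y ⟨v, j⟩ := by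
  rw [edgeWeight_of_val_eq y _
    ((Finset.univ : Finset (Fin (frMult r v v))).map (Function.Embedding.sigmaMk v)) rfl,
    Finset.prod_map]
  rfl

/-- If the multiset `{v, …, v}` is not an edge of `P`, then the added edge `{(v,1), …, (v,r)}` is
not an edge of the blow-up, so that its weight counts separately. -/
theorem weight_franklRodl {P : Pattern r V} {v : V} (hv : Sym.replicate r v ∉ P.edges)
    (y : (Σ u : V, Fin (frMult r v u)) → ℝ) :
    (P.franklRodl v).weight y = edgeWeight y (frEdge r v)
      + ∑ e ∈ (P.blowUp (frMult r v)).edges.filter fun e : Sym _ r =>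
          ∀ i : Fin (frMult r v v), (i : ℕ) ≠ 0 →
            (e : Multiset (Σ u : V, Fin (frMult r v u))).count ⟨v, i⟩ ≤ 1, edgeWeight y e := by
  unfold weight franklRodl
  refine Finset.sum_insert fun h => hv ?_
  have h1 := (Finset.mem_filter.1 (Finset.mem_filter.1 h).1).2
  convert h1
  refine (Sym.eq_replicate.2 fun u hu => ?_).symm
  rw [Sym.mem_map] at hu
  obtain ⟨p, hp, rfl⟩ := hu
  have hp' : p ∈ (frEdge r v : Multiset (Σ u : V, Fin (frMult r v u))) := hp
  simp only [frEdge, Sym.coe_mk, Multiset.mem_map] at hp'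
  obtain ⟨i, -, rfl⟩ := hp'
  rfl

theorem map_foldMap_mem {d t : ℕ} (P : Pattern (d + 1) V) (v : V) {R : Finset (Fin t)}
    (hR : R.card = d) {e : Sym (V × Fin t) (d + 1)} (he : e ∈ spreadEdges P t) :
    e.map (foldMap v hR) ∈ (P.blowUp (frMult (d + 1) v)).edges.filter fun e : Sym _ (d + 1) =>
      ∀ i : Fin (frMult (d + 1) v v), (i : ℕ) ≠ 0 →
        (e : Multiset (Σ u : V, Fin (frMult (d + 1) v u))).count ⟨v, i⟩ ≤ 1 := by
  obtain ⟨-, h1, h2⟩ := Finset.mem_filter.1 he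
  refine Finset.mem_filter.2 ⟨Finset.mem_filter.2 ⟨Finset.mem_univ _, ?_⟩, fun i hi => ?_⟩
  · rw [Sym.map_map]
    exact h1
  · have hnd : (e : Multiset (V × Fin t)).Nodup := h2.of_map _
    rw [Sym.coe_map, Multiset.count_map,
      ← Multiset.toFinset_card_of_nodup (hnd.filter _), Finset.card_le_one]
    intro p hp p' hp'
    rw [Multiset.mem_toFinset, Multiset.mem_filter] at hp hp'
    exact eq_of_foldMap_eq hR hi hp.2.symm hp'.2.symm

/-- The `d` copies of `v` in `R` go to distinct copies of `v`, and all others to `(v, 0)`. -/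
theorem prod_mul_sum_le_edgeWeight_frEdge {d t : ℕ} (v : V) {R : Finset (Fin t)} (hR : R.card = d)
    (U : Finset (Fin t)) {x : V × Fin t → ℝ} (hx : ∀ p, 0 ≤ x p) :
    (∏ i ∈ R, x (v, i)) * ∑ i ∈ U \ R, x (v, i)
      ≤ edgeWeight (pushforward (foldMap v hR) x) (frEdge (d + 1) v) := by
  have hm : d + 1 = frMult (d + 1) v v := by simp [frMult]
  rw [edgeWeight_frEdge, ← (finCongr hm).prod_comp, Fin.prod_univ_succ, mul_comm]
  have h0 : ∑ i ∈ U \ R, x (v, i)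
      ≤ pushforward (foldMap v hR) x ⟨v, finCongr hm 0⟩ := by
    refine (Finset.sum_map (U \ R) (copiesEmb v t) x).symm.trans_le ?_
    refine Finset.sum_le_sum_of_subset_of_nonneg (fun p hp => ?_) fun p _ _ => hx p
    obtain ⟨i, hi, rfl⟩ := Finset.mem_map.1 hp
    refine Finset.mem_filter.2 ⟨Finset.mem_univ _, ?_⟩
    have : foldIndex v hR (v, i) = 0 := dif_neg fun h => (Finset.mem_sdiff.1 hi).2 h.2
    exact congrArg (Sigma.mk v) (Fin.ext this)
  have h1 : ∏ i ∈ R, x (v, i)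
      ≤ ∏ j : Fin d, pushforward (foldMap v hR) x ⟨v, finCongr hm j.succ⟩ := by
    rw [← Finset.prod_coe_sort, ← (R.equivFinOfCardEq hR).symm.prod_comp]
    refine Finset.prod_le_prod (fun j _ => hx _) fun j _ => ?_
    refine Finset.single_le_sum (f := x) (fun p _ => hx p)
      (Finset.mem_filter.2 ⟨Finset.mem_univ _, ?_⟩)
    set i := (R.equivFinOfCardEq hR).symm j with hi
    have h2 : foldIndex v hR (v, (i : Fin t)) = (j : ℕ) + 1 := by
      unfold foldIndex
      rw [dif_pos ⟨rfl, i.2⟩]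
      simp [hi]
    exact congrArg (Sigma.mk v) (Fin.ext h2)
  exact mul_le_mul h0 h1 (Finset.prod_nonneg fun i _ => hx _) (pushforward_nonneg _ hx _)

/-- If at most `k` copies of `v` have positive weight, then folding the sparse extension onto the
Frankl–Rödl construction, with the heaviest copies of `v` in `R`, does not decrease the weight. -/
theorem weight_sparseExtension_le {d k t : ℕ} {P : Pattern (d + 1) V} {v : V}
    (hvP : Sym.replicate (d + 1) v ∉ P.edges) (hdk : d ≤ k) (hkt : k ≤ t)
    {A : Finset (Finset (Fin t))} (hA : ∀ S ∈ A, S.card = d + 1)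
    (hsp : ∀ U : Finset (Fin t), U.card ≤ k → d ≤ U.card →
      (edgesInside A U).card + d ≤ U.card)
    {x : V × Fin t → ℝ} (hx : ∀ p, 0 ≤ x p)
    (hk : (Finset.univ.filter fun i => x (v, i) ≠ 0).card ≤ k) (hpos : 0 < ∑ p, x p) :
    (P.sparseExtension v A).weight x ≤ (∑ p, x p) ^ (d + 1) * (P.franklRodl v).lagrangian := by
  obtain ⟨U, hU, hUk⟩ := Finset.exists_superset_card_eq hk (by simpa using hkt)
  obtain ⟨R, -, hRd, hR⟩ := exists_sum_prod_le hA (x := fun i => x (v, i)) (fun i => hx _) U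
    (fun U' hU' => hsp U' ((Finset.card_le_card hU').trans hUk.le)) (by omega)
  have h0 : ∑ S ∈ A, ∏ i ∈ S, x (v, i) = ∑ S ∈ edgesInside A U, ∏ i ∈ S, x (v, i) := by
    symm
    refine Finset.sum_subset (Finset.filter_subset _ _) fun S hS hSU => ?_
    obtain ⟨i, hiS, hiU⟩ : ∃ i ∈ S, i ∉ U := by
      by_contra! h
      exact hSU (Finset.mem_filter.2 ⟨hS, h⟩)
    refine Finset.prod_eq_zero hiS ?_
    by_contra h
    exact hiU (hU (Finset.mem_filter.2 ⟨Finset.mem_univ _, h⟩))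
  have h1 : (P.sparseExtension v A).weight x
      ≤ (P.franklRodl v).weight (pushforward (foldMap v hRd) x) := by
    rw [weight_franklRodl hvP, weight, sparseExtension,
      Finset.sum_union (disjoint_spreadEdges_embeddedEdges hvP A), sum_embeddedEdges _ hA, add_comm]
    refine add_le_add ?_ (sum_edgeWeight_le_pushforward _ hx _ _ fun e he =>
      map_foldMap_mem P v hRd he)
    exact (h0.trans_le hR).trans (prod_mul_sum_le_edgeWeight_frEdge v hRd U hx)
  refine h1.trans ?_
  have h2 := weight_le_sum_pow_mul_lagrangian (P.franklRodl v)
    (pushforward_nonneg (foldMap v hRd) hx) (by rwa [sum_pushforward])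
  rwa [sum_pushforward] at h2

/-- All weight is put on `v`. -/
theorem one_le_factorial_mul_lagrangian {P : Pattern r V} {v : V}
    (hv : Sym.replicate r v ∈ P.edges) : 1 ≤ (r.factorial : ℝ) * P.lagrangian := by
  have h1 : edgeWeight (Pi.single v (1 : ℝ)) (Sym.replicate r v) = 1 / r.factorial := by
    unfold edgeWeight
    rw [Finset.prod_eq_single v]
    · simp [Sym.coe_replicate]
    · intro u _ hu
      simp [Sym.coe_replicate, Multiset.count_replicate, hu.symm]
    · simp
  have h2 : edgeWeight (Pi.single v (1 : ℝ)) (Sym.replicate r v)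
      ≤ P.weight (Pi.single v (1 : ℝ)) :=
    Finset.single_le_sum (f := fun e => edgeWeight (Pi.single v (1 : ℝ)) e)
      (fun e _ => edgeWeight_nonneg (fun u => (single_mem_stdSimplex ℝ v).1 u) e) hv
  have h3 := h2.trans (P.weight_le_lagrangian (single_mem_stdSimplex ℝ v))
  rw [h1, div_le_iff₀ (by positivity)] at h3
  linarith

end

end Pattern

/-! ### Non-jumps -/

/-- The `r`-graph on `Fin N` pulled back from a set of multisets. -/
def RGraph.ofPullback {r N : ℕ} {W : Type*} [DecidableEq W] (f : Fin N → W)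
    (E : Finset (Sym W r)) : RGraph r (Fin N) where
  verts := Finset.univ
  edges := Pattern.pullback f E
  edges_subset := Finset.filter_subset _ _

/-- The number of edges of a subgraph of a blow-up of a pattern is at most the weight of the
pattern, where each vertex of the pattern is weighted by the number of vertices above it. -/
theorem RGraph.IsSubgraph.card_edges_le {r N : ℕ} {W : Type*} [Fintype W] [DecidableEq W]
    {f : Fin N → W} {Q : Pattern r W} {H : RGraph r (Fin N)}
    (hH : H.IsSubgraph (RGraph.ofPullback f Q.edges)) :
    (H.edges.card : ℝ)
      ≤ Q.weight (Pattern.pushforward f fun a => if a ∈ H.verts then 1 else 0) := by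
  have hcard : ∀ S ∈ H.edges, S.card = r := fun S hS =>
    (Finset.mem_powersetCard.1 (H.edges_subset hS)).2
  have h1 : (H.edges.card : ℝ) = ∑ e ∈ Pattern.embeddedEdges r (Function.Embedding.refl _) H.edges,
      Pattern.edgeWeight (fun a => if a ∈ H.verts then (1 : ℝ) else 0) e := by
    rw [Pattern.sum_embeddedEdges _ hcard, Finset.card_eq_sum_ones, Nat.cast_sum]
    refine Finset.sum_congr rfl fun S hS => ?_
    rw [Nat.cast_one]
    exact (Finset.prod_eq_one fun i hi =>
      if_pos ((Finset.mem_powersetCard.1 (H.edges_subset hS)).1 hi)).symm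
  rw [h1]
  refine Pattern.sum_edgeWeight_le_pushforward f (fun a => ?_) _ _ fun e he => ?_
  · split_ifs <;> norm_num
  · obtain ⟨-, S, hS, h⟩ := Finset.mem_filter.1 he
    obtain ⟨e', he', h'⟩ := (Finset.mem_filter.1 (hH.2 hS)).2
    have : e.map f = e' := by
      apply Subtype.ext
      rw [Finset.map_refl] at h
      exact (congrArg (Multiset.map f) h).trans h'.symm
    rwa [this]

/-- An `r`-graph of large order `n` and density at least `α + δ` has more than `α n ^ r / r!`
edges. -/
theorem exists_pow_lt_mul_descFactorial (d : ℕ) {α δ : ℝ} (hα : 0 ≤ α) (hδ : 0 < δ) :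
    ∃ n : ℕ, d + 1 ≤ n ∧ α * (n : ℝ) ^ (d + 1) < (α + δ) * n.descFactorial (d + 1) := by
  obtain ⟨m, hm⟩ := exists_nat_gt ((α + δ) * ((d : ℝ) + 1) ^ 2 / δ)
  refine ⟨m + (d + 1), by omega, ?_⟩
  set n := m + (d + 1) with hn
  have hmn : (m : ℝ) ≤ n := by exact_mod_cast (by omega : m ≤ n)
  have hn0 : (0 : ℝ) < n := by exact_mod_cast (by omega : 0 < n)
  rw [div_lt_iff₀ hδ] at hm
  have h1 := mul_le_mul_of_nonneg_left (pow_succ_le_descFactorial_add n d)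
    (show 0 ≤ α + δ by positivity)
  have h2 : (α + δ) * ((d : ℝ) + 1) ^ 2 < n * δ :=
    hm.trans_le (mul_le_mul_of_nonneg_right hmn hδ.le)
  have h3 := mul_lt_mul_of_pos_right h2 (show (0 : ℝ) < (n : ℝ) ^ d by positivity)
  have h4 : (n : ℝ) ^ (d + 1) = n * (n : ℝ) ^ d := by ring
  rw [h4] at h1 ⊢
  linarith

theorem mainTheorem1 {r : ℕ} (hr : 1 ≤ r) {V : Type*} [Fintype V] [DecidableEq V]
    (P : Pattern r V) (v : V)
    (hv : ∃ w : V → ℝ, P.IsMaximalWeighting w ∧ 0 < w v)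
    (hFR : (P.franklRodl v).lagrangian = P.lagrangian)
    (hlt : P.lagrangian < 1) :
    ¬ IsJump r ((r.factorial : ℝ) * P.lagrangian) := by
  rintro ⟨⟨hα0, hα1⟩, δ, hδ, hjump⟩
  obtain ⟨d, rfl⟩ : ∃ d, r = d + 1 := ⟨r - 1, by omega⟩
  obtain ⟨w, ⟨hw, hwmax⟩, hwv⟩ := hv
  have hvP : Sym.replicate (d + 1) v ∉ P.edges := fun h =>
    absurd (Pattern.one_le_factorial_mul_lagrangian h) (not_le.2 hα1)
  obtain ⟨n, hdn, hn⟩ := exists_pow_lt_mul_descFactorial d hα0 hδ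
  -- The constant `c` makes the edges of `A` outweigh the loss of order `(d + 1) ^ 2 / t`.
  obtain ⟨c, hc⟩ := exists_nat_gt (P.weight w * ((d : ℝ) + 1) ^ 2 / w v ^ (d + 1))
  rw [div_lt_iff₀ (by positivity)] at hc
  obtain ⟨t, ht, hnt, A, hA, hAcard, hAsp⟩ := exists_locally_sparse d n c
  set Q := P.sparseExtension v A with hQ
  set y : V × Fin t → ℝ := fun p => w p.1 / t with hy
  have hgain : P.lagrangian < Q.weight y := by
    rw [← hwmax]
    exact Pattern.weight_lt_weight_sparseExtension hvP hw.1 ht hA hc hAcard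
  have hysimp : y ∈ stdSimplex ℝ (V × Fin t) := by
    have ht' : (t : ℝ) ≠ 0 := by exact_mod_cast ht.ne'
    refine ⟨fun p => div_nonneg (hw.1 _) (Nat.cast_nonneg _), ?_⟩
    rw [Fintype.sum_prod_type]
    simp only [hy, Finset.sum_const, Finset.card_univ, Fintype.card_fin, nsmul_eq_mul]
    rw [Finset.sum_congr rfl fun u _ => mul_div_cancel₀ (w u) ht']
    exact hw.2
  have hfac : (0 : ℝ) < (d + 1).factorial := by positivity
  -- A random blow-up of `Q` has expected density `α + ε`, where `ε` is the factor `r!` times the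
  -- weight gained.
  obtain ⟨N, hN⟩ := hjump ((d + 1).factorial * (Q.weight y - P.lagrangian))
    (mul_pos hfac (sub_pos.2 hgain)) n hdn
  -- At least `d + 1` vertices are needed, as the density of a smaller graph is `0 / 0 = 0`.
  set M := max N (d + 1) with hM
  obtain ⟨f, hf⟩ := Pattern.exists_card_pullback_ge (α := Fin M) Q.edges hysimp
  obtain ⟨H, hHsub, hHn, hHd⟩ := hN (Fin M) (RGraph.ofPullback f Q.edges)
    (by simp [RGraph.order, RGraph.ofPullback, hM]) (by
      have hpos : (0 : ℝ) < M.choose (d + 1) := by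
        exact_mod_cast Nat.choose_pos (le_max_right N (d + 1))
      rw [RGraph.density, RGraph.ofPullback, Finset.card_powersetCard, Finset.card_univ,
        Fintype.card_fin, le_div_iff₀ hpos]
      rw [Fintype.card_fin] at hf
      refine le_trans (le_of_eq ?_) hf
      rw [Pattern.weight]
      ring)
  set z : Fin M → ℝ := fun a => if a ∈ H.verts then 1 else 0 with hz
  have hz0 : ∀ a, 0 ≤ z a := fun a => by
    simp only [hz]
    split_ifs <;> norm_num
  have hHcard : H.verts.card = n := hHn
  have hzsum : ∑ p, Pattern.pushforward f z p = n := by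
    rw [Pattern.sum_pushforward]
    simp [hz, hHcard]
  have hsupp : (Finset.univ.filter fun i => Pattern.pushforward f z (v, i) ≠ 0).card ≤ n := by
    rw [← hHcard]
    refine le_trans (Finset.card_le_card fun i hi => ?_)
      (Finset.card_image_le (s := H.verts) (f := fun a => (f a).2))
    obtain ⟨a, ha, hza⟩ := Finset.exists_ne_zero_of_sum_ne_zero (Finset.mem_filter.1 hi).2
    have ha' : a ∈ H.verts := by
      by_contra h
      exact hza (if_neg h)
    exact Finset.mem_image.2 ⟨a, ha', congrArg Prod.snd (Finset.mem_filter.1 ha).2⟩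
  have hupper := hHsub.card_edges_le.trans
    (Pattern.weight_sparseExtension_le hvP (by omega) hnt hA hAsp
      (Pattern.pushforward_nonneg f hz0) hsupp (by
        rw [hzsum]
        exact_mod_cast (by omega : 0 < n)))
  rw [hzsum, hFR] at hupper
  have hchoose : (0 : ℝ) < n.choose (d + 1) := by exact_mod_cast Nat.choose_pos hdn
  rw [RGraph.density, Finset.card_powersetCard, hHcard, le_div_iff₀ hchoose] at hHd
  rw [Nat.descFactorial_eq_factorial_mul_choose, Nat.cast_mul] at hn
  have h1 := mul_le_mul_of_nonneg_left (hHd.trans hupper) hfac.le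
  linarith
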